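/- Let $n,m\ge 0$, $\epsilon\ge 0$. For $x=(a|b)\in\mathbb Z_2^{2n}$ let $E_x=X^aZ^b$ be the Pauli error on $n$ qubits, and let $B(x,x')=a'\cdot b-a\cdot b'$ be the symplectic form. A stabilizer code is given by an Abelian subgroup $S$ of the group $\{i^cE_x\}$ containing no multiple of $I$ other than $I$. Let $Q\subseteq\mathbb Z_2^{2n}$ be the set of $x$ such that a multiple of $E_x$ is in $S$, and $Q^\perp=\{y: B(x,y)=0\ \forall x\in Q\}$. For a pattern $y$ of eigenvalues of the elements of $S$ (a syndrome), let $P_y$ be the projector on the corresponding joint eigenspace (the coset of the code with syndrome $y$). The code encodes $m$ qubits if every coset has dimension $2^m$; a decoding procedure is then a choice, for each $y$, of an operator $D_y$ mapping the coset with syndrome $y$ unitarily onto $(\mathbb C^2)^{\otimes m}$ and vanishing on its orthogonal complement. Let $\mathcal K$ be a finite nonempty set and $\{Q_k\}_{k\in\mathcal K}$ a stabilizer purity testing code with error $\epsilon$: stabilizer codes on $n$ qubits, each encoding $m$ qubits, such that $\#\{k: x\in Q_k^\perp\setminus Q_k\}\le\epsilon\,\#\mathcal K$ for every $x\ne0$.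 Fix a decoding procedure for each $Q_k$. Let $|\Phi^+\rangle=(|00\rangle+|11\rangle)/\sqrt2$, each party holding half of each pair. Consider the following protocol $\mathcal T$ for Alice and Bob, who hold $n$ qubits each. A uniformly random $k\in\mathcal K$ is chosen and announced. Alice measures the syndrome of $Q_k$ (projectors $P_y$). Bob measures the syndrome of $Q_k$, labelled by the complex conjugate convention, i.e. with projectors $\overline{P_{y}}$ (entrywise conjugate in the computational basis; since $\overline{E}=\pm E$ for every Hermitian Pauli operator $E$, this is the same measurement up to a fixed relabelling of the outcomes, and exactly the same when all elements of $S$ are real). They compare their outcomes $y,y'$. If $y=y'$, they decode, Alice by $D_y$ and Bob by $\overline{D_y}$, and Bob sets a flag qubit to $|\mathrm{acc}\rangle$. Otherwise Bob sets it to $|\mathrm{rej}\rangle$, and Alice and Bob apply arbitrary local channels from $n$ to $m$ qubits, which may depend on $k,y,y'$. Then $\mathcal T$ is a purity testing protocol with error $\epsilon$, that is: 1. $\mathcal T$ is a superoperator from $2n$ to $2m+1$ qubits that can be implemented with local operations and (finitely many rounds of) classical communication. 2. (Completeness) $\mathcal T$ maps the state $|\Phi^+\rangle^{\otimes n}$ to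 the state $|\Phi^+\rangle^{\otimes m}\otimes|\mathrm{acc}\rangle$. 3. (Soundness) Let $P$ be the orthogonal projection onto the span of $|\Phi^+\rangle^{\otimes m}\otimes|\mathrm{acc}\rangle$ and of all $|\psi\rangle\otimes|\mathrm{rej}\rangle$ with $|\psi\rangle$ a vector of $2m$ qubits. Then $\mathrm{Tr}(P\,\mathcal T(\rho))\ge1-\epsilon$ for every density matrix $\rho$ on $2n$ qubits. -/

import Mathlib

open scoped Matrix Kronecker ComplexOrder

/-- Computational basis labels of an `n`-qubit register. -/
abbrev Qubits (n : ℕ) : Type := Fin n → ZMod 2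

/-- Vectors `x = (a | b)` of `ℤ₂²ⁿ`, labelling the error basis. -/
abbrev PauliVec (n : ℕ) : Type := Qubits n × Qubits n

/-- The error operator `E_x = X^a Z^b` for `x = (a | b)`: it sends the basis vector `|j⟩` to
`(-1)^(b · j) |j + a⟩`. -/
noncomputable def pauli {n : ℕ} (x : PauliVec n) : Matrix (Qubits n) (Qubits n) ℂ :=
  Matrix.of fun i j => if i = j + x.1 then (-1 : ℂ) ^ (x.2 ⬝ᵥ j).val else 0

/-- The symplectic form `B(x, y) = a' · b - a · b'` for `x = (a | b)`, `y = (a' | b')`. -/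
def symp {n : ℕ} (x y : PauliVec n) : ZMod 2 := y.1 ⬝ᵥ x.2 - x.1 ⬝ᵥ y.2

/-- A stabilizer code on `n` qubits: an Abelian subgroup of the Pauli group `{i^c E_x}` that
contains no multiple of the identity other than the identity. -/
structure StabilizerCode (n : ℕ) where
  S : Subgroup (Matrix.unitaryGroup (Qubits n) ℂ)
  pauli_mem : ∀ s ∈ S, ∃ (c : Fin 4) (x : PauliVec n),
    (s : Matrix (Qubits n) (Qubits n) ℂ) = Complex.I ^ (c : ℕ) • pauli x
  comm : ∀ s ∈ S, ∀ t ∈ S, s * t = t * s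
  no_scalar : ∀ s ∈ S, ∀ c : ℂ,
    (s : Matrix (Qubits n) (Qubits n) ℂ) = c • (1 : Matrix (Qubits n) (Qubits n) ℂ) → c = 1

/-- The matrix of the orthogonal projection onto a subspace. -/
noncomputable def projMatrix {ι : Type} [Fintype ι] [DecidableEq ι]
    (U : Submodule ℂ (EuclideanSpace ℂ ι)) : Matrix ι ι ℂ :=
  (Matrix.toEuclideanCLM (𝕜 := ℂ) (n := ι)).symm U.starProjection

namespace StabilizerCode

variable {n : ℕ} (C : StabilizerCode n)

/-- The set `Q` of vectors `x` such that some multiple of `E_x` lies in the stabilizer. -/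
def vectors : Set (PauliVec n) :=
  {x | ∃ s ∈ C.S, ∃ c : ℂ, (s : Matrix (Qubits n) (Qubits n) ℂ) = c • pauli x}

/-- `Q^⊥`, the vectors of the errors that commute with the whole stabilizer. -/
def perp : Set (PauliVec n) := {y | ∀ x ∈ C.vectors, symp x y = 0}

/-- A syndrome: a pattern of eigenvalues `±1` of the elements of the stabilizer. (Every joint
eigenvalue pattern that occurs is multiplicative, so these are the characters of the group.) -/
abbrev Syndrome : Type := C.S →* ℤˣ

instance finite_S : Finite C.S := by
  have h : Set.Finite (Set.range fun p : Fin 4 × PauliVec n =>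
      Complex.I ^ (p.1 : ℕ) • pauli p.2) := Set.finite_range _
  have := h.to_subtype
  refine Finite.of_injective
    (β := Set.range fun p : Fin 4 × PauliVec n => Complex.I ^ (p.1 : ℕ) • pauli p.2)
    (fun s => ⟨(s : Matrix.unitaryGroup (Qubits n) ℂ), ?_⟩) ?_
  · obtain ⟨c, x, hx⟩ := C.pauli_mem s s.2
    exact ⟨(c, x), hx.symm⟩
  · intro s t hst
    exact Subtype.ext (Subtype.ext (Subtype.mk.inj hst))

noncomputable instance fintypeSyndrome : Fintype C.Syndrome :=
  have : Finite C.Syndrome := DFunLike.finite _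
  Fintype.ofFinite _

noncomputable instance decidableEqSyndrome : DecidableEq C.Syndrome := Classical.decEq _

/-- The coset of the code with syndrome `y`: the joint eigenvectors of the stabilizer with
eigenvalue pattern `y`. The trivial syndrome gives the code space. -/
def coset (y : C.Syndrome) : Submodule ℂ (EuclideanSpace ℂ (Qubits n)) where
  carrier := {ψ | ∀ s : C.S, Matrix.toEuclideanCLM (𝕜 := ℂ) (n := Qubits n)
    ((s : Matrix.unitaryGroup (Qubits n) ℂ) : Matrix (Qubits n) (Qubits n) ℂ) ψ
      = ((y s : ℤ) : ℂ) • ψ}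
  add_mem' := by
    intro a b ha hb s
    rw [map_add, ha s, hb s, smul_add]
  zero_mem' := by
    intro s
    rw [map_zero, smul_zero]
  smul_mem' := by
    intro c a ha s
    rw [map_smul, ha s, smul_comm]

/-- The projector of the syndrome measurement that belongs to the outcome `y`. -/
noncomputable def syndromeProj (y : C.Syndrome) : Matrix (Qubits n) (Qubits n) ℂ :=
  projMatrix (C.coset y)

/-- A decoding procedure onto `m` qubits: for each syndrome `y`, an operator that maps the coset
with syndrome `y` unitarily onto the space of `m` qubits (and kills its orthogonal complement). -/
structure Decoder (m : ℕ) where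
  D : C.Syndrome → Matrix (Qubits m) (Qubits n) ℂ
  onto : ∀ y, D y * (D y)ᴴ = 1
  support : ∀ y, (D y)ᴴ * D y = C.syndromeProj y

end StabilizerCode

/-- The codes `Q_k`, `k ∈ K`, form a stabilizer purity testing code with error `ε`: for each
`x ≠ 0`, at most `ε · #K` of the `k` satisfy `x ∈ Q_k^⊥ - Q_k`. -/
def IsPurityTestingCode {n : ℕ} {K : Type} [Fintype K] (Q : K → StabilizerCode n) (ε : ℝ) :
    Prop :=
  ∀ x : PauliVec n, x ≠ 0 →
    (Nat.card {k : K // x ∈ (Q k).perp \ (Q k).vectors} : ℝ) ≤ ε * (Fintype.card K : ℝ)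

/-- The map `ρ ↦ M ρ M†`. -/
def conjBy {ι κ : Type} [Fintype ι] [Fintype κ] (M : Matrix κ ι ℂ) :
    Matrix ι ι ℂ →ₗ[ℂ] Matrix κ κ ℂ where
  toFun ρ := M * ρ * Mᴴ
  map_add' ρ σ := by rw [Matrix.mul_add, Matrix.add_mul]
  map_smul' c ρ := by simp

/-- Maps on a bipartite system that can be implemented with local operations and (finitely many
rounds of) classical communication. In each round one party performs a local quantum operation
with Kraus operators `M i`, announces `i`, and the rest of the protocol depends on `i`. Local
randomness, ancillas, and discarding of systems or of outcomes are instances of such a round.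
All such maps are completely positive and trace preserving. -/
inductive IsLOCC {A' B' : Type} [Fintype A'] [DecidableEq A'] [Fintype B'] [DecidableEq B'] :
    ∀ (A B : Type) [Fintype A] [DecidableEq A] [Fintype B] [DecidableEq B],
      (Matrix (A × B) (A × B) ℂ →ₗ[ℂ] Matrix (A' × B') (A' × B') ℂ) → Prop
  | done : IsLOCC A' B' LinearMap.id
  | alice (A B : Type) [Fintype A] [DecidableEq A] [Fintype B] [DecidableEq B]
      (ι : Type) [Fintype ι] (A₁ : ι → Type) [∀ i, Fintype (A₁ i)] [∀ i, DecidableEq (A₁ i)]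
      (M : ∀ i, Matrix (A₁ i) A ℂ) (hM : ∑ i, (M i)ᴴ * M i = 1)
      (T : ∀ i, Matrix (A₁ i × B) (A₁ i × B) ℂ →ₗ[ℂ] Matrix (A' × B') (A' × B') ℂ)
      (hT : ∀ i, IsLOCC (A₁ i) B (T i)) :
      IsLOCC A B (∑ i, T i ∘ₗ conjBy (M i ⊗ₖ (1 : Matrix B B ℂ)))
  | bob (A B : Type) [Fintype A] [DecidableEq A] [Fintype B] [DecidableEq B]
      (ι : Type) [Fintype ι] (B₁ : ι → Type) [∀ i, Fintype (B₁ i)] [∀ i, DecidableEq (B₁ i)]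
      (M : ∀ i, Matrix (B₁ i) B ℂ) (hM : ∑ i, (M i)ᴴ * M i = 1)
      (T : ∀ i, Matrix (A × B₁ i) (A × B₁ i) ℂ →ₗ[ℂ] Matrix (A' × B') (A' × B') ℂ)
      (hT : ∀ i, IsLOCC A (B₁ i) (T i)) :
      IsLOCC A B (∑ i, T i ∘ₗ conjBy ((1 : Matrix A A ℂ) ⊗ₖ M i))

/-- The state `|Φ⁺⟩^{⊗n}` of `n` EPR pairs, Alice holding the first register. -/
noncomputable def epr (n : ℕ) : EuclideanSpace ℂ (Qubits n × Qubits n) :=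
  WithLp.toLp 2 fun p => if p.1 = p.2 then ((Real.sqrt (2 ^ n))⁻¹ : ℂ) else 0

/-- The vector `|ψ⟩ ⊗ |v⟩`, where `v` is the flag qubit (`true` for accept, `false` for reject),
held by Bob. -/
def withFlag {m : ℕ} (ψ : EuclideanSpace ℂ (Qubits m × Qubits m)) (v : Bool) :
    EuclideanSpace ℂ (Qubits m × (Qubits m × Bool)) :=
  WithLp.toLp 2 fun p => if p.2.2 = v then ψ (p.1, p.2.1) else 0

/-- The density matrix `|ψ⟩⟨ψ|`. -/
def pureState {ι : Type} (ψ : EuclideanSpace ℂ ι) : Matrix ι ι ℂ :=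
  Matrix.of fun i j => ψ i * star (ψ j)

/-- The span of `|Φ⁺⟩^{⊗m} ⊗ |acc⟩` and of all the `|ψ⟩ ⊗ |rej⟩`. -/
def goodSpace (m : ℕ) : Submodule ℂ (EuclideanSpace ℂ (Qubits m × (Qubits m × Bool))) :=
  Submodule.span ℂ ({withFlag (epr m) true} ∪ Set.range fun ψ => withFlag ψ false)

/-- Purity testing protocols with error `ε`, from `2n` to `2m + 1` qubits. -/
structure IsPurityTestingProtocol {n m : ℕ}
    (T : Matrix (Qubits n × Qubits n) (Qubits n × Qubits n) ℂ →ₗ[ℂ]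
      Matrix (Qubits m × (Qubits m × Bool)) (Qubits m × (Qubits m × Bool)) ℂ) (ε : ℝ) :
    Prop where
  locc : IsLOCC (Qubits n) (Qubits n) T
  completeness : T (pureState (epr n)) = pureState (withFlag (epr m) true)
  soundness : ∀ ρ : Matrix (Qubits n × Qubits n) (Qubits n × Qubits n) ℂ,
    ρ.PosSemidef → ρ.trace = 1 → 1 - ε ≤ (projMatrix (goodSpace m) * T ρ).trace.re

/-- A quantum operation (channel) from `n` to `m` qubits, by Kraus operators. -/
structure Channel (n m : ℕ) where
  r : ℕ
  kraus : Fin r → Matrix (Qubits m) (Qubits n) ℂ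
  complete : ∑ i, (kraus i)ᴴ * kraus i = 1

/-- Append the flag qubit in the state `|v⟩`. -/
def appendFlag (m : ℕ) (v : Bool) : Matrix (Qubits m × Bool) (Qubits m) ℂ :=
  Matrix.of fun p b => if p.1 = b ∧ p.2 = v then 1 else 0

/-- The entrywise complex conjugate of a matrix. -/
def conjMatrix {ι κ : Type} (M : Matrix ι κ ℂ) : Matrix ι κ ℂ := M.map star

/-- The protocol: a uniformly random `k` is picked; Alice measures the syndrome of `Q_k` and gets
`y`, Bob measures his and gets `y'`. If `y = y'`, they decode and set the flag to accept;
otherwise they set the flag to reject (and then apply arbitrary local channels `RA`, `RB`, which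
may depend on everything announced, to bring the registers to the output size).

Bob's measurement and decoding are the entrywise complex conjugates of Alice's. As the conjugate
of a Pauli operator `s` is `s` or `-s`, this is the measurement of the same commuting observables,
with the outcomes labelled so that EPR pairs give equal syndromes; it is literally Alice's
measurement if the stabilizer consists of real matrices `± X^a Z^b`. -/
noncomputable def testProtocol {n m : ℕ} {K : Type} [Fintype K] (Q : K → StabilizerCode n)
    (dec : ∀ k, (Q k).Decoder m)
    (RA RB : ∀ k, (Q k).Syndrome → (Q k).Syndrome → Channel n m) :
    Matrix (Qubits n × Qubits n) (Qubits n × Qubits n) ℂ →ₗ[ℂ]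
      Matrix (Qubits m × (Qubits m × Bool)) (Qubits m × (Qubits m × Bool)) ℂ :=
  (Fintype.card K : ℂ)⁻¹ • ∑ k, ∑ y : (Q k).Syndrome, ∑ y' : (Q k).Syndrome,
    (if y = y' then
        conjBy ((dec k).D y ⊗ₖ (appendFlag m true * conjMatrix ((dec k).D y')))
      else
        ∑ i, ∑ j, conjBy ((RA k y y').kraus i ⊗ₖ (appendFlag m false * (RB k y y').kraus j)))
      ∘ₗ conjBy ((Q k).syndromeProj y ⊗ₖ conjMatrix ((Q k).syndromeProj y'))

/-! Read an operator M as the bipartite vector |M⟩ (`rowVec`). Then A ⊗ conj(B) sends |M⟩ to |A M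
B†⟩ (`kronecker_mulVec_rowVec`), the EPR state is the normalised |1⟩, and the |E_x⟩ are the
(unnormalised) Bell basis. Completeness follows: unequal syndromes occur with amplitude P_y P_{y'} =
0, and a decoded equal pair is |D_y D_y†⟩ = |1⟩.

For soundness, LOCC maps preserve the trace (`IsLOCC.trace_eq`), so it suffices to bound the weight
of the output on "accepted but orthogonal to the EPR state". Pulled back through the decoders of one
code, this projector becomes ∑_y (P_y ⊗ conj(P_y) - 2^{-m} |P_y⟩⟨P_y|). It is diagonal in the Bell
basis (`sum_syndrome_operator`): the first term keeps |E_x⟩ exactly when x ∈ Q^⊥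
(`sum_syndromeProj_pauli`), the second exactly when x ∈ Q (`sum_trace_smul_syndromeProj`), and Q ⊆
Q^⊥. Hence the error probability of a code is the Bell weight of ρ on Q^⊥ \ Q. Averaging over k and
exchanging sums, each x ≠ 0 is counted for at most a fraction ε of the codes, x = 0 never, and the
Bell weights form a probability distribution.

The facts on syndromes come from character theory of the stabilizer, an elementary Abelian 2-group:
P_y is the average of y(s) s (`syndromeProj_eq`), and orthogonality of characters gives ∑_y P_y = 1.
-/

section

/-! ### The sign character and the Pauli matrices -/

/-- The sign `(-1)^a` for `a : ZMod 2`. -/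
noncomputable def sgn (a : ZMod 2) : ℂ := (-1) ^ a.val

lemma zmod_two_cases (a : ZMod 2) : a = 0 ∨ a = 1 := by
  revert a; decide

@[simp] lemma sgn_zero : sgn 0 = 1 := by simp [sgn]

@[simp] lemma sgn_one : sgn 1 = -1 := by simp [sgn, ZMod.val_one]

lemma sgn_add (a b : ZMod 2) : sgn (a + b) = sgn a * sgn b := by
  have h : (1 + 1 : ZMod 2) = 0 := by decide
  rcases zmod_two_cases a with rfl | rfl <;> rcases zmod_two_cases b with rfl | rfl <;> simp [h]

@[simp] lemma star_sgn (a : ZMod 2) : star (sgn a) = sgn a := by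
  rcases zmod_two_cases a with rfl | rfl <;> simp

lemma sgn_mul_self (a : ZMod 2) : sgn a * sgn a = 1 := by
  rcases zmod_two_cases a with rfl | rfl <;> simp

lemma sgn_sub (a b : ZMod 2) : sgn (a - b) = sgn a * sgn b := by
  have h : a - b = a + b := by
    rcases zmod_two_cases a with rfl | rfl <;> rcases zmod_two_cases b with rfl | rfl <;> decide
  rw [h, sgn_add]

/-- If b has a nonzero coordinate i, translating j by the i-th unit vector flips every sign, so the
sum equals its own negative. -/
lemma sum_sgn_dotProduct {n : ℕ} (b : Qubits n) :
    ∑ j : Qubits n, sgn (b ⬝ᵥ j) = if b = 0 then (2 : ℂ) ^ n else 0 := by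
  split_ifs with hb
  · subst hb
    simp [ZMod.card]
  · obtain ⟨i, hi⟩ := Function.ne_iff.1 hb
    have hi : b i = 1 := (zmod_two_cases (b i)).resolve_left hi
    have h := Equiv.sum_comp (Equiv.addRight (Pi.single i (1 : ZMod 2))) fun j => sgn (b ⬝ᵥ j)
    simp only [Equiv.coe_addRight, dotProduct_add, dotProduct_single, hi, sgn_add, mul_one, sgn_one,
      mul_neg, Finset.sum_neg_distrib] at h
    linear_combination (-1 / 2 : ℂ) * h

variable {n : ℕ}

lemma pauli_apply (x : PauliVec n) (i j : Qubits n) :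
    pauli x i j = if i = j + x.1 then sgn (x.2 ⬝ᵥ j) else 0 := rfl

lemma pauli_zero : pauli (0 : PauliVec n) = 1 := by
  ext i j
  simp [pauli_apply, Matrix.one_apply]

lemma pauli_mul_pauli (x y : PauliVec n) :
    pauli x * pauli y = sgn (x.2 ⬝ᵥ y.1) • pauli (x + y) := by
  ext i j
  simp only [Matrix.mul_apply, Matrix.smul_apply, pauli_apply, mul_ite, mul_zero, ite_mul, zero_mul,
    Finset.sum_ite_eq', Finset.mem_univ, if_true, Prod.fst_add, Prod.snd_add,
    smul_eq_mul]
  rw [show j + y.1 + x.1 = j + (x.1 + y.1) by abel]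
  split_ifs
  · simp only [dotProduct_add, add_dotProduct, sgn_add]
    ring
  · rfl

lemma pauli_mul_comm (x y : PauliVec n) :
    pauli x * pauli y = sgn (symp x y) • (pauli y * pauli x) := by
  rw [pauli_mul_pauli, pauli_mul_pauli, smul_smul, symp, sgn_sub, add_comm y x,
    dotProduct_comm y.1, dotProduct_comm x.1, mul_assoc, sgn_mul_self, mul_one]

lemma pauliVec_add_self (x : PauliVec n) : x + x = 0 := by
  have h : ∀ a : ZMod 2, a + a = 0 := by decide
  ext i <;> simp [h]

lemma pauliVec_add_eq_zero {x y : PauliVec n} : x + y = 0 ↔ x = y := by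
  constructor
  · intro h
    have := congrArg (· + y) h
    simpa [add_assoc, pauliVec_add_self] using this
  · rintro rfl
    exact pauliVec_add_self x

lemma pauli_mul_self (x : PauliVec n) : pauli x * pauli x = sgn (x.2 ⬝ᵥ x.1) • 1 := by
  rw [pauli_mul_pauli, pauliVec_add_self, pauli_zero]

lemma trace_pauli {x : PauliVec n} (hx : x ≠ 0) : (pauli x).trace = 0 := by
  simp only [Matrix.trace, Matrix.diag, pauli_apply, left_eq_add]
  by_cases h : x.1 = 0
  · have h2 : x.2 ≠ 0 := fun h2 => hx (Prod.ext h h2)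
    simp only [h, if_true]
    rw [sum_sgn_dotProduct, if_neg h2]
  · simp [h]

lemma trace_pauli_mul_pauli {x y : PauliVec n} (h : x ≠ y) : (pauli x * pauli y).trace = 0 := by
  rw [pauli_mul_pauli, Matrix.trace_smul, trace_pauli (mt pauliVec_add_eq_zero.1 h), smul_zero]

/-- Completeness of the Pauli basis, entrywise: the X-part a is determined by the positions of the
entries, and the sum over the Z-part b is a character sum. It yields the resolution of the identity
by Bell vectors. -/
lemma sum_pauli_mul_star (p q : Qubits n × Qubits n) :
    ∑ x : PauliVec n, pauli x p.1 p.2 * star (pauli x q.1 q.2) = if p = q then (2 : ℂ) ^ n else 0 := by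
  have key : ∀ a b : Qubits n, pauli (a, b) p.1 p.2 * star (pauli (a, b) q.1 q.2) =
      if a = p.1 - p.2 then (if a = q.1 - q.2 then sgn ((p.2 - q.2) ⬝ᵥ b) else 0) else 0 := by
    intro a b
    have h1 : p.1 = p.2 + a ↔ a = p.1 - p.2 := by rw [eq_sub_iff_add_eq', eq_comm]
    have h2 : q.1 = q.2 + a ↔ a = q.1 - q.2 := by rw [eq_sub_iff_add_eq', eq_comm]
    simp only [pauli_apply, h1, h2]
    split_ifs <;> simp [sub_dotProduct, sgn_sub, dotProduct_comm b]
  rw [Fintype.sum_prod_type]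
  simp only [key, Finset.sum_ite_irrel, Finset.sum_const_zero, Finset.sum_ite_eq', Finset.mem_univ,
    if_true, sum_sgn_dotProduct, sub_eq_zero]
  by_cases h : p.2 = q.2
  · simp [h, Prod.ext_iff]
  · simp [h, Prod.ext_iff]

/-! ### Matrices of orthogonal projections -/

/-- For w in U, self-adjointness and p w = w give ⟨w, v - p v⟩ = 0, which characterises p v as the
orthogonal projection of v. -/
lemma projMatrix_eq {ι : Type} [Fintype ι] [DecidableEq ι]
    (U : Submodule ℂ (EuclideanSpace ℂ ι)) (p : Matrix ι ι ℂ) (hp : pᴴ = p)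
    (hmem : ∀ v : EuclideanSpace ℂ ι, WithLp.toLp 2 (p *ᵥ v.ofLp) ∈ U)
    (hfix : ∀ w ∈ U, p *ᵥ w.ofLp = w.ofLp) : projMatrix U = p := by
  rw [projMatrix]
  refine (StarAlgEquiv.symm_apply_eq _).2 ?_
  ext1 v
  refine Submodule.eq_starProjection_of_mem_of_inner_eq_zero (hmem v) fun w hw => ?_
  rw [EuclideanSpace.inner_eq_star_dotProduct]
  change w.ofLp ⬝ᵥ star (v.ofLp - p *ᵥ v.ofLp) = 0
  rw [star_sub, dotProduct_sub, sub_eq_zero, Matrix.star_mulVec, hp,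
    dotProduct_comm _ (_ ᵥ* _), ← Matrix.dotProduct_mulVec, hfix w hw, dotProduct_comm]

end

/-! ### Syndrome projectors -/

lemma Matrix.eq_zero_of_eq_neg {ι κ : Type*} {M : Matrix ι κ ℂ} (h : M = -M) : M = 0 :=
  Matrix.ext fun i j => self_eq_neg.1 (congrFun (congrFun h i) j)

namespace StabilizerCode

variable {n : ℕ} (C : StabilizerCode n)

/-- The matrix of an element of the stabilizer. -/
def mat (s : C.S) : Matrix (Qubits n) (Qubits n) ℂ :=
  ((s : Matrix.unitaryGroup (Qubits n) ℂ) : Matrix (Qubits n) (Qubits n) ℂ)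

/-- The eigenvalue of `s` in the pattern `y`. -/
def eig {C : StabilizerCode n} (y : C.Syndrome) (s : C.S) : ℂ := ((y s : ℤ) : ℂ)

lemma mat_mul (s t : C.S) : C.mat (s * t) = C.mat s * C.mat t := rfl

lemma mat_one : C.mat 1 = 1 := rfl

lemma exists_mat_eq (s : C.S) : ∃ c : ℂ, ∃ x : PauliVec n, C.mat s = c • pauli x := by
  obtain ⟨c, x, h⟩ := C.pauli_mem s s.2
  exact ⟨_, x, h⟩

lemma eq_one_of_mat (s : C.S) (c : ℂ) (h : C.mat s = c • 1) : s = 1 := by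
  have hc := C.no_scalar s s.2 c h
  rw [hc, one_smul] at h
  exact Subtype.ext (Subtype.ext h)

/-- The square of a multiple of a Pauli matrix is scalar, and the only scalar in the stabilizer is
1. So the stabilizer consists of Hermitian involutions. -/
lemma mul_self (s : C.S) : s * s = 1 := by
  obtain ⟨c, x, h⟩ := C.exists_mat_eq s
  refine C.eq_one_of_mat _ (c * c * sgn (x.2 ⬝ᵥ x.1)) ?_
  rw [mat_mul, h, smul_mul_smul_comm, pauli_mul_self, smul_smul]

lemma inv_eq (s : C.S) : s⁻¹ = s := inv_eq_of_mul_eq_one_left (C.mul_self s)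

lemma mat_conjTranspose (s : C.S) : (C.mat s)ᴴ = C.mat s :=
  congrArg C.mat (C.inv_eq s)

variable {C}

lemma eig_mul (y : C.Syndrome) (s t : C.S) : eig y (s * t) = eig y s * eig y t := by
  simp [eig]

lemma eig_one (y : C.Syndrome) : eig y 1 = 1 := by simp [eig]

lemma eig_mul_left (y z : C.Syndrome) (s : C.S) : eig (y * z) s = eig y s * eig z s := by
  simp [eig]

lemma eig_cases (y : C.Syndrome) (s : C.S) : eig y s = 1 ∨ eig y s = -1 := by
  rcases Int.units_eq_one_or (y s) with h | h <;> simp [eig, h]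

lemma eig_mul_self (y : C.Syndrome) (s : C.S) : eig y s * eig y s = 1 := by
  rcases eig_cases y s with h | h <;> simp [h]

lemma eig_ne_zero (y : C.Syndrome) (s : C.S) : eig y s ≠ 0 := by
  rcases eig_cases y s with h | h <;> simp [h]

lemma star_eig (y : C.Syndrome) (s : C.S) : star (eig y s) = eig y s := by
  rcases eig_cases y s with h | h <;> simp [h]

variable (C)

noncomputable instance fintypeS : Fintype C.S := Fintype.ofFinite _

lemma card_S_ne_zero : (Fintype.card C.S : ℂ) ≠ 0 := Nat.cast_ne_zero.2 Fintype.card_ne_zero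

variable {C}

lemma mem_coset_iff {y : C.Syndrome} {ψ : EuclideanSpace ℂ (Qubits n)} :
    ψ ∈ C.coset y ↔ ∀ s : C.S, C.mat s *ᵥ ψ.ofLp = eig y s • ψ.ofLp :=
  forall_congr' fun _ => (WithLp.ofLp_injective 2).eq_iff.symm

lemma mat_mul_sum (y : C.Syndrome) (s : C.S) :
    C.mat s * ∑ t, eig y t • C.mat t = eig y s • ∑ t, eig y t • C.mat t := by
  rw [Finset.mul_sum, ← Equiv.sum_comp (Equiv.mulLeft s) fun t => eig y t • C.mat t,
    Finset.smul_sum]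
  refine Finset.sum_congr rfl fun t _ => ?_
  rw [Equiv.coe_mulLeft, mat_mul, eig_mul, smul_smul, ← mul_assoc, eig_mul_self, one_mul,
    Matrix.mul_smul]

/-- Projection onto an isotypic component by averaging over the group against the character; y is
real-valued, so no conjugate appears. -/
lemma syndromeProj_eq (y : C.Syndrome) :
    C.syndromeProj y = (Fintype.card C.S : ℂ)⁻¹ • ∑ s, eig y s • C.mat s := by
  refine projMatrix_eq _ _ ?_ (fun v => mem_coset_iff.2 fun s => ?_) fun w hw => ?_
  · simp only [Matrix.conjTranspose_smul, Matrix.conjTranspose_sum, mat_conjTranspose, star_eig,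
      star_inv₀, star_natCast]
  · change C.mat s *ᵥ (_ *ᵥ v.ofLp) = eig y s • (_ *ᵥ v.ofLp)
    rw [Matrix.mulVec_mulVec, Matrix.mul_smul, mat_mul_sum, smul_comm, Matrix.smul_mulVec]
  · have h : ∀ s : C.S, (eig y s • C.mat s) *ᵥ w.ofLp = w.ofLp := fun s => by
      rw [Matrix.smul_mulVec, mem_coset_iff.1 hw s, smul_smul, eig_mul_self, one_smul]
    rw [Matrix.smul_mulVec, Matrix.sum_mulVec]
    simp only [h, Finset.sum_const, Finset.card_univ]
    rw [← Nat.cast_smul_eq_nsmul ℂ, smul_smul, inv_mul_cancel₀ C.card_S_ne_zero, one_smul]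

lemma mat_mul_syndromeProj (y : C.Syndrome) (s : C.S) :
    C.mat s * C.syndromeProj y = eig y s • C.syndromeProj y := by
  rw [syndromeProj_eq, Matrix.mul_smul, mat_mul_sum, smul_comm]

lemma conjTranspose_syndromeProj (y : C.Syndrome) : (C.syndromeProj y)ᴴ = C.syndromeProj y := by
  rw [syndromeProj_eq]
  simp only [Matrix.conjTranspose_smul, Matrix.conjTranspose_sum, mat_conjTranspose, star_eig,
      star_inv₀, star_natCast]

lemma syndromeProj_mul_mat (y : C.Syndrome) (s : C.S) :
    C.syndromeProj y * C.mat s = eig y s • C.syndromeProj y := by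
  rw [← Matrix.conjTranspose_inj, Matrix.conjTranspose_mul, mat_conjTranspose,
    Matrix.conjTranspose_smul, conjTranspose_syndromeProj, mat_mul_syndromeProj, star_eig]

lemma syndromeProj_mul_self (y : C.Syndrome) :
    C.syndromeProj y * C.syndromeProj y = C.syndromeProj y := by
  conv_lhs => enter [1]; rw [syndromeProj_eq]
  rw [Matrix.smul_mul, Finset.sum_mul]
  simp only [Matrix.smul_mul, mat_mul_syndromeProj, smul_smul, eig_mul_self, one_smul,
    Finset.sum_const, Finset.card_univ]
  rw [← Nat.cast_smul_eq_nsmul ℂ, smul_smul, inv_mul_cancel₀ C.card_S_ne_zero, one_smul]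

/-- Insert an s on which y and z differ between the projectors: absorbing it to the left or to the
right gives different eigenvalues. -/
lemma syndromeProj_mul_of_ne {y z : C.Syndrome} (h : y ≠ z) :
    C.syndromeProj y * C.syndromeProj z = 0 := by
  obtain ⟨s, hs⟩ := DFunLike.ne_iff.1 h
  have hs' : eig y s - eig z s ≠ 0 := by
    rw [sub_ne_zero]
    intro h'
    exact hs (Units.ext (by simpa [eig] using h'))
  have h1 : eig y s • (C.syndromeProj y * C.syndromeProj z) =
      eig z s • (C.syndromeProj y * C.syndromeProj z) := by
    rw [← Matrix.smul_mul, ← syndromeProj_mul_mat, Matrix.mul_assoc, mat_mul_syndromeProj,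
      Matrix.mul_smul]
  rw [← sub_eq_zero, ← sub_smul] at h1
  exact (smul_eq_zero.1 h1).resolve_left hs'

variable (C) in
/-- The stabilizer as a commutative group. -/
abbrev commGroupS : CommGroup C.S :=
  { (inferInstance : Group C.S) with mul_comm := fun s t => Subtype.ext (C.comm s s.2 t t.2) }

variable (C) in
-- The exponent divides 2, so the roots of unity ±1 of ℤ suffice for duality of finite Abelian
-- groups. This makes the `ℤˣ`-valued syndromes the full character group.
lemma hasEnoughRootsOfUnity : HasEnoughRootsOfUnity ℤ (Monoid.exponent C.S) := by
  have h2 : HasEnoughRootsOfUnity ℤ 2 :=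
    { prim := ⟨-1, IsPrimitiveRoot.neg_one 0 (by norm_num)⟩
      cyc := rootsOfUnity.isCyclic ℤ 2 }
  exact HasEnoughRootsOfUnity.of_dvd ℤ (n := 2)
    (Monoid.exponent_dvd_of_forall_pow_eq_one fun s => by rw [pow_two, C.mul_self])

/-- Some character z has z(s) = -1; multiplying all y by z permutes the syndromes and negates the
sum. -/
lemma sum_eig (s : C.S) (hs : s ≠ 1) : ∑ y : C.Syndrome, eig y s = 0 := by
  let _ := C.commGroupS
  have := C.hasEnoughRootsOfUnity
  obtain ⟨z, hz⟩ := CommGroup.exists_apply_ne_one_of_hasEnoughRootsOfUnity C.S ℤ hs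
  have hz' : eig z s = -1 := by
    simp [eig, (Int.units_eq_one_or (z s)).resolve_left hz]
  have h := Equiv.sum_comp (Equiv.mulLeft z) fun y : C.Syndrome => eig y s
  simp only [Equiv.coe_mulLeft, eig_mul_left, hz', neg_mul, one_mul, Finset.sum_neg_distrib] at h
  linear_combination (-1 / 2 : ℂ) * h

variable (C) in
lemma card_syndrome : Fintype.card C.Syndrome = Fintype.card C.S := by
  let _ := C.commGroupS
  have := C.hasEnoughRootsOfUnity
  rw [← Nat.card_eq_fintype_card, ← Nat.card_eq_fintype_card]
  exact CommGroup.card_monoidHom_of_hasEnoughRootsOfUnity C.S ℤ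

variable (C) in
-- After exchanging sums, orthogonality of characters leaves only s = 1, with coefficient (number of
-- syndromes) / (order of the group) = 1.
lemma sum_syndromeProj : ∑ y, C.syndromeProj y = 1 := by
  classical
  simp only [syndromeProj_eq]
  rw [← Finset.smul_sum, Finset.sum_comm]
  simp only [← Finset.sum_smul]
  rw [Finset.sum_eq_single 1 (fun s _ hs => by rw [sum_eig s hs, zero_smul])
    (fun h => absurd (Finset.mem_univ _) h)]
  simp only [eig_one, Finset.sum_const, Finset.card_univ, C.card_syndrome, mat_one]
  rw [nsmul_eq_mul, mul_one, smul_smul, inv_mul_cancel₀ C.card_S_ne_zero, one_smul]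

/-! ### Pauli errors and syndrome projectors -/

lemma exists_of_mem_vectors {x : PauliVec n} (hx : x ∈ C.vectors) :
    ∃ (s : C.S) (c : ℂ), c ≠ 0 ∧ C.mat s = c • pauli x := by
  obtain ⟨s, hs, c, h⟩ := hx
  refine ⟨⟨s, hs⟩, c, ?_, h⟩
  rintro rfl
  rw [zero_smul] at h
  have h1 := C.mul_self ⟨s, hs⟩
  have h2 := congrArg C.mat h1
  rw [mat_mul, mat_one, show C.mat ⟨s, hs⟩ = 0 from h, Matrix.mul_zero] at h2
  exact zero_ne_one h2

lemma mem_vectors_of_mat {s : C.S} {c : ℂ} {x : PauliVec n} (h : C.mat s = c • pauli x) :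
    x ∈ C.vectors := ⟨s, s.2, c, h⟩

lemma zero_mem_vectors : (0 : PauliVec n) ∈ C.vectors :=
  mem_vectors_of_mat (s := 1) (c := 1) (by rw [mat_one, pauli_zero, one_smul])

lemma syndromeProj_mul_pauli_comm {x : PauliVec n} (hx : x ∈ C.perp) (y : C.Syndrome) :
    C.syndromeProj y * pauli x = pauli x * C.syndromeProj y := by
  have h : ∀ s : C.S, C.mat s * pauli x = pauli x * C.mat s := fun s => by
    obtain ⟨c, z, hz⟩ := C.exists_mat_eq s
    rw [hz, Matrix.smul_mul, pauli_mul_comm, hx z (mem_vectors_of_mat hz), sgn_zero, one_smul,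
      Matrix.mul_smul]
  rw [syndromeProj_eq, Matrix.smul_mul, Matrix.mul_smul, Finset.sum_mul, Finset.mul_sum]
  simp only [Matrix.smul_mul, Matrix.mul_smul, h]

/-- A detectable error anticommutes with some stabilizer element s; moving s through it from one
projector to the other produces a sign. -/
lemma syndromeProj_mul_pauli_mul_syndromeProj {x : PauliVec n} (hx : x ∉ C.perp)
    (y : C.Syndrome) : C.syndromeProj y * pauli x * C.syndromeProj y = 0 := by
  simp only [perp, Set.mem_ofPred_eq, not_forall] at hx
  obtain ⟨z, hz, hzx⟩ := hx
  obtain ⟨s, c, -, hs⟩ := exists_of_mem_vectors hz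
  have hcomm : C.mat s * pauli x = -(pauli x * C.mat s) := by
    rw [hs, Matrix.smul_mul, pauli_mul_comm, (zmod_two_cases _).resolve_left hzx, sgn_one,
      Matrix.mul_smul, neg_one_smul, smul_neg]
  have h : eig y s • (C.syndromeProj y * pauli x * C.syndromeProj y) =
      -(eig y s • (C.syndromeProj y * pauli x * C.syndromeProj y)) := by
    conv_lhs => rw [← Matrix.smul_mul, ← Matrix.smul_mul, ← syndromeProj_mul_mat,
      Matrix.mul_assoc _ (C.mat s), hcomm, Matrix.mul_neg, Matrix.neg_mul, Matrix.mul_assoc,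
      Matrix.mul_assoc, mat_mul_syndromeProj, Matrix.mul_smul, Matrix.mul_smul]
    rw [Matrix.mul_assoc]
  exact (smul_eq_zero.1 (Matrix.eq_zero_of_eq_neg h)).resolve_left (eig_ne_zero y s)

lemma sum_syndromeProj_pauli (x : PauliVec n) [Decidable (x ∈ C.perp)] :
    ∑ y, C.syndromeProj y * pauli x * C.syndromeProj y = if x ∈ C.perp then pauli x else 0 := by
  split_ifs with hx
  · simp only [syndromeProj_mul_pauli_comm hx, Matrix.mul_assoc, syndromeProj_mul_self]
    rw [← Finset.mul_sum, sum_syndromeProj, Matrix.mul_one]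
  · simp only [syndromeProj_mul_pauli_mul_syndromeProj hx, Finset.sum_const_zero]

lemma trace_syndromeProj_mul_pauli {x : PauliVec n} (hx : x ∉ C.vectors) (y : C.Syndrome) :
    (C.syndromeProj y * pauli x).trace = 0 := by
  rw [syndromeProj_eq, Matrix.smul_mul, Finset.sum_mul, Matrix.trace_smul, Matrix.trace_sum]
  refine smul_eq_zero_of_right _ (Finset.sum_eq_zero fun s _ => ?_)
  obtain ⟨c, z, hz⟩ := C.exists_mat_eq s
  have hne : z ≠ x := by
    rintro rfl
    exact hx (mem_vectors_of_mat hz)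
  rw [hz, Matrix.smul_mul, Matrix.smul_mul, Matrix.trace_smul, Matrix.trace_smul,
    trace_pauli_mul_pauli hne, smul_zero, smul_zero]

/-- Two stabilizer elements with symplectic form 1 would both commute and anticommute, so their
product would vanish although it is invertible. -/
lemma vectors_subset_perp : C.vectors ⊆ C.perp := by
  intro x hx z hz
  obtain ⟨s, c, hc, hs⟩ := exists_of_mem_vectors hx
  obtain ⟨t, d, hd, ht⟩ := exists_of_mem_vectors hz
  by_contra hzx
  have h : C.mat t * C.mat s = C.mat s * C.mat t :=
    congrArg C.mat (Subtype.ext (C.comm t t.2 s s.2) : t * s = s * t)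
  have h2 : C.mat t * C.mat s = -(C.mat s * C.mat t) := by
    rw [hs, ht, smul_mul_smul_comm, pauli_mul_comm, (zmod_two_cases _).resolve_left hzx, sgn_one,
      smul_mul_smul_comm, neg_one_smul, smul_neg, mul_comm c]
  rw [h] at h2
  have h3 := Matrix.eq_zero_of_eq_neg h2
  rw [← h, ← mat_mul] at h3
  have h4 := congrArg (C.mat (t * s) * ·) h3
  simp only [← mat_mul, C.mul_self, Matrix.mul_zero, mat_one] at h4
  exact one_ne_zero h4

/-- For x ∈ Q, E_x is a multiple of a stabilizer element, hence scalar on each coset, and the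
normalised trace reads off that scalar: the sum is the spectral decomposition. For x ∉ Q every trace
vanishes. -/
lemma sum_trace_smul_syndromeProj {d : ℂ} (hd : d ≠ 0)
    (htr : ∀ y, (C.syndromeProj y).trace = d) (x : PauliVec n) [Decidable (x ∈ C.vectors)] :
    ∑ y, (d⁻¹ * (C.syndromeProj y * pauli x).trace) • C.syndromeProj y =
      if x ∈ C.vectors then pauli x else 0 := by
  split_ifs with hx
  · obtain ⟨s, c, hc, hs⟩ := exists_of_mem_vectors hx
    have hp : pauli x = c⁻¹ • C.mat s := by rw [hs, smul_smul, inv_mul_cancel₀ hc, one_smul]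
    have h : ∀ y, (d⁻¹ * (C.syndromeProj y * pauli x).trace) • C.syndromeProj y =
        c⁻¹ • (C.mat s * C.syndromeProj y) := fun y => by
      rw [hp, Matrix.mul_smul, syndromeProj_mul_mat, Matrix.trace_smul, Matrix.trace_smul, htr,
        mat_mul_syndromeProj]
      simp only [smul_eq_mul, smul_smul]
      congr 1
      field_simp
    rw [Finset.sum_congr rfl fun y _ => h y, ← Finset.smul_sum, ← Finset.mul_sum, sum_syndromeProj,
      Matrix.mul_one, ← hp]
  · simp only [trace_syndromeProj_mul_pauli hx, mul_zero, zero_smul, Finset.sum_const_zero]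

end StabilizerCode

section

/-! ### Maps `ρ ↦ M ρ M†` and LOCC -/

section ConjBy

variable {ι κ μ : Type} [Fintype ι] [Fintype κ] [Fintype μ]

lemma conjBy_apply (M : Matrix κ ι ℂ) (ρ : Matrix ι ι ℂ) : conjBy M ρ = M * ρ * Mᴴ := rfl

lemma conjBy_conjBy (M : Matrix μ κ ℂ) (N : Matrix κ ι ℂ) (ρ : Matrix ι ι ℂ) :
    conjBy M (conjBy N ρ) = conjBy (M * N) ρ := by
  simp only [conjBy_apply, Matrix.conjTranspose_mul, Matrix.mul_assoc]

lemma conjBy_zero : conjBy (0 : Matrix κ ι ℂ) = 0 := by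
  refine LinearMap.ext fun ρ => ?_
  simp [conjBy_apply]

lemma conjBy_one [DecidableEq ι] : conjBy (1 : Matrix ι ι ℂ) = LinearMap.id := by
  refine LinearMap.ext fun ρ => ?_
  simp [conjBy_apply]

lemma conjBy_smul (c : ℂ) (M : Matrix κ ι ℂ) : conjBy (c • M) = (c * star c) • conjBy M := by
  refine LinearMap.ext fun ρ => ?_
  simp [conjBy_apply, smul_smul, mul_comm]

end ConjBy

section ConjMatrix

variable {ι κ μ : Type}

lemma conjMatrix_mul [Fintype κ] (M : Matrix μ κ ℂ) (N : Matrix κ ι ℂ) :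
    conjMatrix (M * N) = conjMatrix M * conjMatrix N :=
  Matrix.map_mul (f := starRingEnd ℂ)

lemma conjMatrix_conjTranspose (M : Matrix κ ι ℂ) : conjMatrix Mᴴ = (conjMatrix M)ᴴ := rfl

lemma conjMatrix_one [DecidableEq ι] : conjMatrix (1 : Matrix ι ι ℂ) = 1 :=
  Matrix.map_one _ (star_zero ℂ) (star_one ℂ)

lemma conjMatrix_zero : conjMatrix (0 : Matrix κ ι ℂ) = 0 :=
  Matrix.map_zero _ (star_zero ℂ)

lemma conjMatrix_sum {α : Type} (s : Finset α) (M : α → Matrix κ ι ℂ) :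
    conjMatrix (∑ a ∈ s, M a) = ∑ a ∈ s, conjMatrix (M a) := by
  ext i j
  simp [conjMatrix, Matrix.sum_apply]

lemma kronecker_mul_kronecker {ι' κ' μ' : Type} [Fintype κ] [Fintype κ'] (A : Matrix μ κ ℂ) (B : Matrix κ ι ℂ)
    (A' : Matrix μ' κ' ℂ) (B' : Matrix κ' ι' ℂ) :
    (A ⊗ₖ A') * (B ⊗ₖ B') = (A * B) ⊗ₖ (A' * B') :=
  (Matrix.mul_kronecker_mul A B A' B').symm

end ConjMatrix

namespace IsLOCC

variable {A B A₁ B₁ A' B' : Type} [Fintype A] [DecidableEq A] [Fintype B] [DecidableEq B]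
  [Fintype A₁] [DecidableEq A₁] [Fintype B₁] [DecidableEq B₁]
  [Fintype A'] [DecidableEq A'] [Fintype B'] [DecidableEq B']

/-- Alice applies the operation `M`, announces the result, and Bob applies the operation `N`. -/
lemma alice_bob {ι κ : Type} [Fintype ι] [Fintype κ] (M : ι → Matrix A₁ A ℂ)
    (hM : ∑ i, (M i)ᴴ * M i = 1) (N : κ → Matrix B₁ B ℂ) (hN : ∑ j, (N j)ᴴ * N j = 1)
    (T : ι → κ → Matrix (A₁ × B₁) (A₁ × B₁) ℂ →ₗ[ℂ] Matrix (A' × B') (A' × B') ℂ)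
    (hT : ∀ i j, IsLOCC A₁ B₁ (T i j)) :
    IsLOCC A B (∑ i, ∑ j, T i j ∘ₗ conjBy (M i ⊗ₖ N j)) := by
  have h := IsLOCC.alice A B ι (fun _ => A₁) M hM
    (fun i => ∑ j, T i j ∘ₗ conjBy ((1 : Matrix A₁ A₁ ℂ) ⊗ₖ N j))
    fun i => IsLOCC.bob A₁ B κ (fun _ => B₁) N hN (T i) (hT i)
  convert h using 3 with i
  refine LinearMap.ext fun ρ => ?_
  simp only [LinearMap.sum_apply, LinearMap.comp_apply]
  refine Finset.sum_congr rfl fun j _ => congrArg (T i j) ?_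
  rw [conjBy_conjBy, kronecker_mul_kronecker, Matrix.one_mul, Matrix.mul_one]

/-- A product of two local operations. -/
lemma product {ι κ : Type} [Fintype ι] [Fintype κ] (M : ι → Matrix A' A ℂ)
    (hM : ∑ i, (M i)ᴴ * M i = 1) (N : κ → Matrix B' B ℂ) (hN : ∑ j, (N j)ᴴ * N j = 1) :
    IsLOCC A B (∑ i, ∑ j, conjBy (M i ⊗ₖ N j)) :=
  alice_bob M hM N hN (fun _ _ => LinearMap.id) fun _ _ => IsLOCC.done

/-- A uniformly random choice, announced by Alice. -/
lemma average {K : Type} [Fintype K] [Nonempty K]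
    (T : K → Matrix (A × B) (A × B) ℂ →ₗ[ℂ] Matrix (A' × B') (A' × B') ℂ)
    (hT : ∀ k, IsLOCC A B (T k)) : IsLOCC A B ((Fintype.card K : ℂ)⁻¹ • ∑ k, T k) := by
  -- The random choice is a round with Kraus operators a · 1, one for each k; completeness forces
  -- |a|² = 1 / #K.
  obtain ⟨a, ha⟩ : ∃ a : ℂ, a = (((Real.sqrt (Fintype.card K))⁻¹ : ℝ) : ℂ) := ⟨_, rfl⟩
  have haa : a * star a = (Fintype.card K : ℂ)⁻¹ := by
    have h : star a = a := by rw [ha]; exact Complex.conj_ofReal _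
    rw [h, ha, ← Complex.ofReal_mul, ← mul_inv, Real.mul_self_sqrt (Nat.cast_nonneg _)]
    push_cast
    rfl
  have hc : (Fintype.card K : ℂ) ≠ 0 := Nat.cast_ne_zero.2 Fintype.card_ne_zero
  have h := IsLOCC.alice A B K (fun _ => A) (fun _ => a • (1 : Matrix A A ℂ)) (by
    simp only [Matrix.conjTranspose_smul, Matrix.conjTranspose_one, smul_mul_smul_comm, mul_one,
      mul_comm (star a), haa, Finset.sum_const, Finset.card_univ]
    rw [← Nat.cast_smul_eq_nsmul ℂ, smul_smul, mul_inv_cancel₀ hc, one_smul]) T hT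
  convert h using 1
  rw [Finset.smul_sum]
  refine Finset.sum_congr rfl fun k _ => ?_
  rw [Matrix.smul_kronecker, Matrix.one_kronecker_one, conjBy_smul, conjBy_one, haa,
    LinearMap.comp_smul, LinearMap.comp_id]

/-- LOCC maps preserve the trace. -/
lemma trace_eq {T : Matrix (A × B) (A × B) ℂ →ₗ[ℂ] Matrix (A' × B') (A' × B') ℂ}
    (h : IsLOCC A B T) (ρ : Matrix (A × B) (A × B) ℂ) : (T ρ).trace = ρ.trace := by
  induction h with
  | done => rfl
  | alice A B ι A₁ M hM T hT ih =>
    simp only [LinearMap.sum_apply, LinearMap.comp_apply, Matrix.trace_sum, ih, conjBy_apply]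
    simp only [Matrix.trace_mul_cycle _ ρ]
    rw [← Matrix.trace_sum, ← Finset.sum_mul]
    simp only [Matrix.conjTranspose_kronecker, kronecker_mul_kronecker, Matrix.conjTranspose_one,
      Matrix.one_mul]
    rw [show ∑ i, ((M i)ᴴ * M i) ⊗ₖ (1 : Matrix B B ℂ) = (∑ i, (M i)ᴴ * M i) ⊗ₖ 1 from
      (map_sum ((Matrix.kroneckerBilinear (R := ℂ) (α := ℂ)).flip 1) _ _).symm, hM,
      Matrix.one_kronecker_one, Matrix.one_mul]
  | bob A B ι B₁ M hM T hT ih =>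
    simp only [LinearMap.sum_apply, LinearMap.comp_apply, Matrix.trace_sum, ih, conjBy_apply]
    simp only [Matrix.trace_mul_cycle _ ρ]
    rw [← Matrix.trace_sum, ← Finset.sum_mul]
    simp only [Matrix.conjTranspose_kronecker, kronecker_mul_kronecker, Matrix.conjTranspose_one,
      Matrix.one_mul]
    rw [show ∑ i, (1 : Matrix A A ℂ) ⊗ₖ ((M i)ᴴ * M i) = 1 ⊗ₖ (∑ i, (M i)ᴴ * M i) from
      (map_sum (Matrix.kroneckerBilinear (R := ℂ) (α := ℂ) 1) _ _).symm, hM,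
      Matrix.one_kronecker_one, Matrix.one_mul]

end IsLOCC

/-! ### The flag -/

lemma appendFlag_conjTranspose_mul (m : ℕ) (v w : Bool) :
    (appendFlag m v)ᴴ * appendFlag m w = if v = w then 1 else 0 := by
  ext i j
  simp only [Matrix.mul_apply, Matrix.conjTranspose_apply, appendFlag, Matrix.of_apply]
  rw [Fintype.sum_prod_type]
  cases v <;> cases w <;> simp [Matrix.one_apply, ite_and, eq_comm]

lemma sum_appendFlag_mul (m : ℕ) :
    appendFlag m true * (appendFlag m true)ᴴ + appendFlag m false * (appendFlag m false)ᴴ = 1 := by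
  ext ⟨i, u⟩ ⟨j, v⟩
  simp only [Matrix.add_apply, Matrix.mul_apply, Matrix.conjTranspose_apply, appendFlag,
    Matrix.of_apply]
  cases u <;> cases v <;> simp [Matrix.one_apply]

/-! ### The protocol is LOCC -/

namespace StabilizerCode.Decoder

variable {n m : ℕ} {C : StabilizerCode n}

lemma mul_syndromeProj (d : C.Decoder m) (y : C.Syndrome) : d.D y * C.syndromeProj y = d.D y := by
  rw [← d.support, ← Matrix.mul_assoc, d.onto, Matrix.one_mul]

lemma mul_syndromeProj_of_ne (d : C.Decoder m) {y z : C.Syndrome} (h : z ≠ y) : d.D z * C.syndromeProj y = 0 := by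
  rw [← d.mul_syndromeProj z, Matrix.mul_assoc, syndromeProj_mul_of_ne h, Matrix.mul_zero]

lemma trace_syndromeProj (d : C.Decoder m) (y : C.Syndrome) : (C.syndromeProj y).trace = 2 ^ m := by
  rw [← d.support, Matrix.trace_mul_comm, d.onto, Matrix.trace_one]
  simp [ZMod.card]

/-- Trace of ∑_y P_y = 1, each coset having dimension 2^m. -/
lemma card_syndrome_mul (d : C.Decoder m) : (Fintype.card C.Syndrome : ℂ) * 2 ^ m = 2 ^ n := by
  have h := congrArg Matrix.trace C.sum_syndromeProj
  rw [Matrix.trace_sum, Matrix.trace_one] at h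
  simpa [d.trace_syndromeProj, ZMod.card] using h

end StabilizerCode.Decoder

variable {n m : ℕ}

/-- The part of the protocol that belongs to the code `C`. -/
noncomputable def codeProtocol {C : StabilizerCode n} (d : C.Decoder m)
    (RA RB : C.Syndrome → C.Syndrome → Channel n m) :
    Matrix (Qubits n × Qubits n) (Qubits n × Qubits n) ℂ →ₗ[ℂ]
      Matrix (Qubits m × (Qubits m × Bool)) (Qubits m × (Qubits m × Bool)) ℂ :=
  ∑ y : C.Syndrome, ∑ y' : C.Syndrome,
    (if y = y' then
        conjBy (d.D y ⊗ₖ (appendFlag m true * conjMatrix (d.D y')))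
      else
        ∑ i, ∑ j, conjBy ((RA y y').kraus i ⊗ₖ (appendFlag m false * (RB y y').kraus j)))
      ∘ₗ conjBy (C.syndromeProj y ⊗ₖ conjMatrix (C.syndromeProj y'))

lemma testProtocol_eq {K : Type} [Fintype K] (Q : K → StabilizerCode n)
    (dec : ∀ k, (Q k).Decoder m) (RA RB : ∀ k, (Q k).Syndrome → (Q k).Syndrome → Channel n m) :
    testProtocol Q dec RA RB =
      (Fintype.card K : ℂ)⁻¹ • ∑ k, codeProtocol (dec k) (RA k) (RB k) := rfl

lemma sum_appendFlag_kraus {ι : Type} [Fintype ι] (v : Bool) (N : ι → Matrix (Qubits m) (Qubits n) ℂ)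
    (hN : ∑ i, (N i)ᴴ * N i = 1) :
    ∑ i, (appendFlag m v * N i)ᴴ * (appendFlag m v * N i) = 1 := by
  rw [← hN]
  refine Finset.sum_congr rfl fun i _ => ?_
  rw [Matrix.conjTranspose_mul, Matrix.mul_assoc, ← Matrix.mul_assoc (appendFlag m v)ᴴ,
    appendFlag_conjTranspose_mul, if_pos rfl, Matrix.one_mul]

lemma isLOCC_codeProtocol {C : StabilizerCode n} (d : C.Decoder m)
    (RA RB : C.Syndrome → C.Syndrome → Channel n m) :
    IsLOCC (Qubits n) (Qubits n) (codeProtocol d RA RB) := by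
  have hD : ∑ y, (d.D y)ᴴ * d.D y = 1 := by simp only [d.support, C.sum_syndromeProj]
  have hD' : ∑ y, (conjMatrix (d.D y))ᴴ * conjMatrix (d.D y) = 1 := by
    simp only [← conjMatrix_conjTranspose, ← conjMatrix_mul, ← conjMatrix_sum, hD, conjMatrix_one]
  have hP : ∑ y, (C.syndromeProj y)ᴴ * C.syndromeProj y = 1 := by
    simp only [StabilizerCode.conjTranspose_syndromeProj, StabilizerCode.syndromeProj_mul_self,
      C.sum_syndromeProj]
  have hP' : ∑ y, (conjMatrix (C.syndromeProj y))ᴴ * conjMatrix (C.syndromeProj y) = 1 := by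
    simp only [← conjMatrix_conjTranspose, ← conjMatrix_mul, ← conjMatrix_sum, hP, conjMatrix_one]
  -- A single D_y is not a complete set of Kraus operators. In the accepting branch both parties
  -- therefore apply the whole family (D_z)_z, complete because ∑ D_z† D_z = ∑ P_z = 1; after
  -- outcome y only z = y survives, since D_z P_y = 0 otherwise.
  have h := IsLOCC.alice_bob _ hP _ hP'
    (fun y y' => if y = y' then
      ∑ z, ∑ z', conjBy (d.D z ⊗ₖ (appendFlag m true * conjMatrix (d.D z')))
      else
      ∑ i, ∑ j, conjBy ((RA y y').kraus i ⊗ₖ (appendFlag m false * (RB y y').kraus j)))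
    (fun y y' => by
      split_ifs
      · exact IsLOCC.product _ hD _ (sum_appendFlag_kraus _ _ hD')
      · exact IsLOCC.product _ (RA y y').complete _ (sum_appendFlag_kraus _ _ (RB y y').complete))
  convert h using 1
  refine Finset.sum_congr rfl fun y _ => Finset.sum_congr rfl fun y' _ => ?_
  split_ifs with hy
  · subst hy
    refine LinearMap.ext fun ρ => ?_
    simp only [LinearMap.comp_apply, LinearMap.sum_apply]
    simp only [conjBy_conjBy, kronecker_mul_kronecker,
      Matrix.mul_assoc, ← conjMatrix_mul]
    symm
    rw [Finset.sum_eq_single y, Finset.sum_eq_single y]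
    · intro z _ hz
      rw [d.mul_syndromeProj_of_ne hz, conjMatrix_zero, Matrix.mul_zero, Matrix.kronecker_zero,
        conjBy_zero, LinearMap.zero_apply]
    · exact fun h => absurd (Finset.mem_univ _) h
    · intro z _ hz
      refine Finset.sum_eq_zero fun z' _ => ?_
      rw [d.mul_syndromeProj_of_ne hz, Matrix.zero_kronecker, conjBy_zero, LinearMap.zero_apply]
    · exact fun h => absurd (Finset.mem_univ _) h
  · rfl

end

section

/-! ### Matrices as bipartite vectors -/

section RowVec

variable {ι κ ι' κ' : Type}

/-- A matrix, read as a vector of the bipartite system. -/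
def rowVec (M : Matrix ι κ ℂ) : ι × κ → ℂ := fun p => M p.1 p.2

/-- The rank one operator `|v⟩⟨v|`. -/
def outer (v : ι → ℂ) : Matrix ι ι ℂ := Matrix.vecMulVec v (star v)

/-- The reason for the conjugate convention on Bob's side: local operations become left and right
multiplication of M. -/
lemma kronecker_mulVec_rowVec [Fintype ι] [Fintype κ] (A : Matrix ι' ι ℂ) (B : Matrix κ' κ ℂ)
    (M : Matrix ι κ ℂ) : (A ⊗ₖ conjMatrix B) *ᵥ rowVec M = rowVec (A * M * Bᴴ) := by
  have h := Matrix.kronecker_mulVec_vec (conjMatrix B) Mᵀ A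
  have h' : conjMatrix B * Mᵀ * Aᵀ = (A * M * Bᴴ)ᵀ := by
    rw [Matrix.transpose_mul, Matrix.transpose_mul, Matrix.mul_assoc]
    rfl
  rw [h'] at h
  exact h

lemma outer_smul (c : ℂ) (v : ι → ℂ) : outer (c • v) = (c * star c) • outer v := by
  rw [outer, outer, star_smul, Matrix.smul_vecMulVec, Matrix.vecMulVec_smul, smul_smul]

lemma conjTranspose_outer (v : ι → ℂ) : (outer v)ᴴ = outer v := by
  rw [outer, Matrix.conjTranspose_vecMulVec, star_star]

lemma mul_outer_mul [Fintype ι] (A : Matrix κ ι ℂ) (v : ι → ℂ) :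
    A * outer v * Aᴴ = outer (A *ᵥ v) := by
  rw [outer, Matrix.mul_vecMulVec, Matrix.vecMulVec_mul, ← Matrix.star_mulVec, outer]

lemma conjBy_outer [Fintype ι] [Fintype κ] (A : Matrix κ ι ℂ) (v : ι → ℂ) :
    conjBy A (outer v) = outer (A *ᵥ v) := mul_outer_mul A v

lemma outer_mulVec [Fintype ι] (v w : ι → ℂ) : outer v *ᵥ w = (star v ⬝ᵥ w) • v := by
  rw [outer, Matrix.vecMulVec_mulVec]
  exact op_smul_eq_smul _ _

lemma star_rowVec_dotProduct [Fintype ι] [Fintype κ] (M N : Matrix ι κ ℂ) :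
    star (rowVec M) ⬝ᵥ rowVec N = (Mᴴ * N).trace := by
  simp only [dotProduct, Fintype.sum_prod_type, Matrix.trace, Matrix.diag, Matrix.mul_apply,
    Matrix.conjTranspose_apply, Pi.star_apply, rowVec]
  exact Finset.sum_comm

lemma trace_outer_mul [Fintype ι] (v : ι → ℂ) (ρ : Matrix ι ι ℂ) :
    (outer v * ρ).trace = star v ⬝ᵥ ρ *ᵥ v := by
  rw [outer, Matrix.vecMulVec_mul, Matrix.trace_vecMulVec, dotProduct_comm,
    Matrix.dotProduct_mulVec]

lemma rowVec_sum {α : Type} (s : Finset α) (M : α → Matrix ι κ ℂ) :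
    rowVec (∑ a ∈ s, M a) = ∑ a ∈ s, rowVec (M a) := by
  ext p
  simp [rowVec, Matrix.sum_apply]

end RowVec

variable {n m : ℕ}

/-- The Bell vectors resolve the identity. -/
lemma sum_outer_pauli : ∑ x : PauliVec n, outer (rowVec (pauli x)) = (2 : ℂ) ^ n • 1 := by
  ext p q
  rw [Matrix.sum_apply]
  refine (sum_pauli_mul_star p q).trans ?_
  simp [Matrix.one_apply]

/-- The probability of an undetected error is carried by the Bell vectors of `Q^⊥ - Q`. -/
lemma sum_syndrome_operator {C : StabilizerCode n} (d : C.Decoder m)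
    [DecidablePred (· ∈ C.perp \ C.vectors)] :
    ∑ y, (C.syndromeProj y ⊗ₖ conjMatrix (C.syndromeProj y) -
      ((2 : ℂ) ^ m)⁻¹ • outer (rowVec (C.syndromeProj y))) =
    ((2 : ℂ) ^ n)⁻¹ • ∑ x : PauliVec n,
      if x ∈ C.perp \ C.vectors then outer (rowVec (pauli x)) else 0 := by
  classical
  set R := ∑ y, (C.syndromeProj y ⊗ₖ conjMatrix (C.syndromeProj y) -
      ((2 : ℂ) ^ m)⁻¹ • outer (rowVec (C.syndromeProj y))) with hR
  have h2 : (2 : ℂ) ^ n ≠ 0 := by positivity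
  -- Every Bell vector is an eigenvector of R, with eigenvalue [x ∈ Q^⊥] - [x ∈ Q].
  have hx : ∀ x, R *ᵥ rowVec (pauli x) =
      if x ∈ C.perp \ C.vectors then rowVec (pauli x) else 0 := by
    intro x
    have h1 : R *ᵥ rowVec (pauli x) =
        rowVec (∑ y, C.syndromeProj y * pauli x * C.syndromeProj y) -
        rowVec (∑ y, (((2 : ℂ) ^ m)⁻¹ * (C.syndromeProj y * pauli x).trace) •
          C.syndromeProj y) := by
      rw [hR, Matrix.sum_mulVec, rowVec_sum, rowVec_sum, ← Finset.sum_sub_distrib]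
      refine Finset.sum_congr rfl fun y _ => ?_
      rw [Matrix.sub_mulVec, kronecker_mulVec_rowVec, Matrix.smul_mulVec, outer_mulVec,
        star_rowVec_dotProduct, StabilizerCode.conjTranspose_syndromeProj, smul_smul]
      rfl
    rw [h1, StabilizerCode.sum_syndromeProj_pauli, StabilizerCode.sum_trace_smul_syndromeProj
      (by positivity) d.trace_syndromeProj]
    have hsub := StabilizerCode.vectors_subset_perp (C := C) (a := x)
    ext p
    by_cases hv : x ∈ C.vectors
    · simp [Set.mem_sdiff, hv, hsub hv]
    · by_cases hp : x ∈ C.perp <;> simp [Set.mem_sdiff, hv, hp, rowVec]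
  -- Insert the resolution of the identity by Bell vectors to the right of R.
  calc R = ((2 : ℂ) ^ n)⁻¹ • (R * ((2 : ℂ) ^ n • 1)) := by
        rw [Matrix.mul_smul, Matrix.mul_one, smul_smul, inv_mul_cancel₀ h2, one_smul]
    _ = _ := by
        rw [← sum_outer_pauli, Finset.mul_sum]
        congr 1
        refine Finset.sum_congr rfl fun x _ => ?_
        rw [outer, Matrix.mul_vecMulVec, hx]
        split_ifs
        · rfl
        · exact Matrix.zero_vecMulVec _

/-! ### EPR pairs with a flag -/

/-- The isometry that appends the flag to Bob's register. -/
noncomputable def flagIsometry (m : ℕ) (v : Bool) :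
    Matrix (Qubits m × (Qubits m × Bool)) (Qubits m × Qubits m) ℂ := 1 ⊗ₖ appendFlag m v

lemma flagIsometry_conjTranspose_mul (m : ℕ) (v w : Bool) :
    (flagIsometry m v)ᴴ * flagIsometry m w = if v = w then 1 else 0 := by
  rw [flagIsometry, flagIsometry, Matrix.conjTranspose_kronecker, kronecker_mul_kronecker,
    appendFlag_conjTranspose_mul, Matrix.conjTranspose_one, Matrix.one_mul]
  split_ifs
  · exact Matrix.one_kronecker_one
  · exact Matrix.kronecker_zero _

lemma sum_flagIsometry_mul (m : ℕ) :
    flagIsometry m true * (flagIsometry m true)ᴴ + flagIsometry m false * (flagIsometry m false)ᴴ =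
      1 := by
  simp only [flagIsometry, Matrix.conjTranspose_kronecker, kronecker_mul_kronecker,
    Matrix.conjTranspose_one, Matrix.one_mul]
  rw [← Matrix.kronecker_add, sum_appendFlag_mul, Matrix.one_kronecker_one]

lemma kronecker_appendFlag_mul {ι κ : Type} (v : Bool) (A : Matrix (Qubits m) ι ℂ)
    (B : Matrix (Qubits m) κ ℂ) :
    A ⊗ₖ (appendFlag m v * B) = flagIsometry m v * (A ⊗ₖ B) := by
  rw [flagIsometry, kronecker_mul_kronecker, Matrix.one_mul]

lemma withFlag_ofLp (ψ : EuclideanSpace ℂ (Qubits m × Qubits m)) (v : Bool) :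
    (withFlag ψ v).ofLp = flagIsometry m v *ᵥ ψ.ofLp := by
  ext ⟨i, j, b⟩
  simp only [Matrix.mulVec, dotProduct, flagIsometry, Matrix.kroneckerMap_apply, appendFlag,
    Matrix.of_apply, Fintype.sum_prod_type, Matrix.one_apply, withFlag]
  by_cases h : b = v <;> simp [h]

lemma star_rowVec_one_dotProduct :
    star (rowVec (1 : Matrix (Qubits m) (Qubits m) ℂ)) ⬝ᵥ rowVec 1 = 2 ^ m := by
  rw [star_rowVec_dotProduct, Matrix.conjTranspose_one, Matrix.one_mul, Matrix.trace_one]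
  simp [ZMod.card]

lemma epr_ofLp (n : ℕ) : (epr n).ofLp = ((Real.sqrt (2 ^ n))⁻¹ : ℂ) • rowVec 1 := by
  ext p
  simp [epr, rowVec, Matrix.one_apply]

lemma sqrt_two_pow_mul_star (n : ℕ) :
    ((Real.sqrt (2 ^ n))⁻¹ : ℂ) * star ((Real.sqrt (2 ^ n))⁻¹ : ℂ) = ((2 : ℂ) ^ n)⁻¹ := by
  rw [star_inv₀, ← mul_inv, show star ((Real.sqrt (2 ^ n) : ℝ) : ℂ) = (Real.sqrt (2 ^ n) : ℝ) from
    Complex.conj_ofReal _, ← Complex.ofReal_mul, Real.mul_self_sqrt (by positivity)]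
  push_cast
  rfl

lemma pureState_epr (n : ℕ) : pureState (epr n) = ((2 : ℂ) ^ n)⁻¹ • outer (rowVec 1) := by
  change outer (epr n).ofLp = _
  rw [epr_ofLp, outer_smul, sqrt_two_pow_mul_star]

lemma pureState_withFlag_epr (m : ℕ) (v : Bool) : pureState (withFlag (epr m) v) =
    ((2 : ℂ) ^ m)⁻¹ • outer (flagIsometry m v *ᵥ rowVec 1) := by
  change outer (withFlag (epr m) v).ofLp = _
  rw [withFlag_ofLp, epr_ofLp, Matrix.mulVec_smul, outer_smul, sqrt_two_pow_mul_star]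

/-- The projector onto the orthogonal complement of the EPR state. -/
noncomputable def eprCompl (m : ℕ) : Matrix (Qubits m × Qubits m) (Qubits m × Qubits m) ℂ :=
  1 - ((2 : ℂ) ^ m)⁻¹ • outer (rowVec 1)

lemma conjTranspose_eprCompl (m : ℕ) : (eprCompl m)ᴴ = eprCompl m := by
  simp only [eprCompl, Matrix.conjTranspose_sub, Matrix.conjTranspose_one,
    Matrix.conjTranspose_smul, conjTranspose_outer, star_inv₀, star_pow, star_ofNat]

/-- Writing the projector as 1 minus the bad event turns soundness into an upper bound on the bad
event; `hE` is the equivalent form "reject, or accept with the EPR state" used to verify it. -/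
lemma projMatrix_goodSpace (m : ℕ) :
    projMatrix (goodSpace m) = 1 - flagIsometry m true *
      eprCompl m * (flagIsometry m true)ᴴ := by
  have h2 : (2 : ℂ) ^ m ≠ 0 := by positivity
  have hft : (flagIsometry m false)ᴴ * flagIsometry m true = 0 := by
    simp [flagIsometry_conjTranspose_mul]
  have htf : (flagIsometry m true)ᴴ * flagIsometry m false = 0 := by
    simp [flagIsometry_conjTranspose_mul]
  have htt : (flagIsometry m true)ᴴ * flagIsometry m true = 1 := by
    simp [flagIsometry_conjTranspose_mul]
  have hE : (1 - flagIsometry m true * eprCompl m *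
      (flagIsometry m true)ᴴ) = flagIsometry m false * (flagIsometry m false)ᴴ +
      ((2 : ℂ) ^ m)⁻¹ • outer (flagIsometry m true *ᵥ rowVec 1) := by
    rw [eprCompl, ← mul_outer_mul, Matrix.mul_sub, Matrix.sub_mul, Matrix.mul_one, Matrix.mul_smul,
      Matrix.smul_mul, ← sum_flagIsometry_mul]
    abel
  refine projMatrix_eq _ _ ?_ (fun v => ?_) fun w hw => ?_
  · rw [Matrix.conjTranspose_sub, Matrix.conjTranspose_one, Matrix.conjTranspose_mul,
      Matrix.conjTranspose_mul, conjTranspose_eprCompl, Matrix.conjTranspose_conjTranspose,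
      Matrix.mul_assoc]
  · have h : WithLp.toLp 2 ((1 - flagIsometry m true * eprCompl m *
        (flagIsometry m true)ᴴ) *ᵥ v.ofLp) =
        withFlag (WithLp.toLp 2 ((flagIsometry m false)ᴴ *ᵥ v.ofLp)) false +
        -- The factor √(2^m) undoes the normalisation of `epr m` relative to `rowVec 1`.
        (((2 : ℂ) ^ m)⁻¹ * (star (flagIsometry m true *ᵥ rowVec 1) ⬝ᵥ v.ofLp) *
          (Real.sqrt (2 ^ m) : ℂ)) • withFlag (epr m) true := by
      apply WithLp.ofLp_injective 2
      rw [WithLp.ofLp_add, WithLp.ofLp_smul, withFlag_ofLp, withFlag_ofLp, epr_ofLp, hE,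
        Matrix.add_mulVec, Matrix.mulVec_mulVec, Matrix.smul_mulVec, outer_mulVec,
        Matrix.mulVec_smul, smul_smul, smul_smul, mul_assoc _ (Real.sqrt (2 ^ m) : ℂ),
        mul_inv_cancel₀, mul_one]
      rw [Complex.ofReal_ne_zero]
      positivity
    rw [h]
    exact add_mem (Submodule.subset_span (Or.inr ⟨_, rfl⟩))
      (Submodule.smul_mem _ _ (Submodule.subset_span (Or.inl rfl)))
  · refine Submodule.span_induction (p := fun w _ => _ *ᵥ w.ofLp = w.ofLp) ?_ ?_ ?_ ?_ hw
    · rintro w (rfl | ⟨ψ, rfl⟩)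
      · rw [withFlag_ofLp, epr_ofLp, Matrix.mulVec_smul, Matrix.mulVec_smul, hE, Matrix.add_mulVec,
          Matrix.mulVec_mulVec, Matrix.mul_assoc, hft, Matrix.mul_zero, Matrix.zero_mulVec,
          zero_add, Matrix.smul_mulVec, outer_mulVec, Matrix.star_mulVec,
          ← Matrix.dotProduct_mulVec, Matrix.mulVec_mulVec, htt, Matrix.one_mulVec,
          star_rowVec_one_dotProduct, smul_smul _ ((2 : ℂ) ^ m), inv_mul_cancel₀ h2, one_smul]
      · rw [withFlag_ofLp, Matrix.mulVec_mulVec, Matrix.sub_mul, Matrix.mul_assoc _ _ᴴ, htf,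
          Matrix.mul_zero, sub_zero, Matrix.one_mul]
    · simp
    · intro v w _ _ hv hw
      rw [WithLp.ofLp_add, Matrix.mulVec_add, hv, hw]
    · intro c v _ hv
      rw [WithLp.ofLp_smul, Matrix.mulVec_smul, hv]

/-! ### Completeness and soundness -/

lemma codeProtocol_apply {C : StabilizerCode n} (d : C.Decoder m)
    (RA RB : C.Syndrome → C.Syndrome → Channel n m)
    (ρ : Matrix (Qubits n × Qubits n) (Qubits n × Qubits n) ℂ) :
    codeProtocol d RA RB ρ = ∑ y : C.Syndrome, ∑ y' : C.Syndrome,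
      if y = y' then
        conjBy (flagIsometry m true * (d.D y ⊗ₖ conjMatrix (d.D y))) ρ
      else
        ∑ i, ∑ j, conjBy (flagIsometry m false * ((RA y y').kraus i ⊗ₖ (RB y y').kraus j))
          (conjBy (C.syndromeProj y ⊗ₖ conjMatrix (C.syndromeProj y')) ρ) := by
  simp only [codeProtocol, LinearMap.sum_apply, LinearMap.comp_apply]
  refine Finset.sum_congr rfl fun y _ => Finset.sum_congr rfl fun y' _ => ?_
  split_ifs with h
  · subst h
    rw [kronecker_appendFlag_mul, conjBy_conjBy, Matrix.mul_assoc, kronecker_mul_kronecker,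
      ← conjMatrix_mul, d.mul_syndromeProj]
  · simp only [LinearMap.sum_apply, kronecker_appendFlag_mul]

/-- Each equal pair of syndromes contributes the same unnormalised EPR state with weight 2^{-n}, and
there are 2^{n-m} syndromes. -/
lemma codeProtocol_epr {C : StabilizerCode n} (d : C.Decoder m)
    (RA RB : C.Syndrome → C.Syndrome → Channel n m) :
    codeProtocol d RA RB (pureState (epr n)) = pureState (withFlag (epr m) true) := by
  have h : ∀ y y' : C.Syndrome, (if y = y' then
        conjBy (flagIsometry m true * (d.D y ⊗ₖ conjMatrix (d.D y))) (pureState (epr n))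
      else
        ∑ i, ∑ j, conjBy (flagIsometry m false * ((RA y y').kraus i ⊗ₖ (RB y y').kraus j))
          (conjBy (C.syndromeProj y ⊗ₖ conjMatrix (C.syndromeProj y')) (pureState (epr n)))) =
      if y = y' then ((2 : ℂ) ^ n)⁻¹ • outer (flagIsometry m true *ᵥ rowVec 1) else 0 := by
    intro y y'
    rw [pureState_epr, map_smul, map_smul, conjBy_outer, conjBy_outer, ← Matrix.mulVec_mulVec,
      kronecker_mulVec_rowVec, kronecker_mulVec_rowVec, Matrix.mul_one, Matrix.mul_one, d.onto,
      StabilizerCode.conjTranspose_syndromeProj]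
    split_ifs with hy
    · rfl
    · have h0 : outer (rowVec (0 : Matrix (Qubits n) (Qubits n) ℂ)) = 0 :=
        Matrix.zero_vecMulVec _
      simp only [StabilizerCode.syndromeProj_mul_of_ne hy, h0, smul_zero, map_zero,
        Finset.sum_const_zero]
  simp only [codeProtocol_apply, h, Finset.sum_ite_eq, Finset.mem_univ, if_true,
    Finset.sum_const, Finset.card_univ]
  have h2 : (2 : ℂ) ^ m ≠ 0 := by positivity
  have h2' : (2 : ℂ) ^ n ≠ 0 := by positivity
  rw [pureState_withFlag_epr, ← Nat.cast_smul_eq_nsmul ℂ, smul_smul]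
  congr 1
  rw [← div_eq_mul_inv, div_eq_iff h2', ← d.card_syndrome_mul]
  field_simp

/-- The probability that the code `C` accepts a wrong state, in terms of Bell vectors. -/
lemma trace_error_codeProtocol {C : StabilizerCode n} (d : C.Decoder m)
    (RA RB : C.Syndrome → C.Syndrome → Channel n m)
    [DecidablePred (· ∈ C.perp \ C.vectors)]
    (ρ : Matrix (Qubits n × Qubits n) (Qubits n × Qubits n) ℂ) :
    (flagIsometry m true * eprCompl m * (flagIsometry m true)ᴴ * codeProtocol d RA RB ρ).trace =
      ((2 : ℂ) ^ n)⁻¹ * ∑ x : PauliVec n,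
        if x ∈ C.perp \ C.vectors then (outer (rowVec (pauli x)) * ρ).trace else 0 := by
  have htt : (flagIsometry m true)ᴴ * flagIsometry m true = 1 := by
    simp [flagIsometry_conjTranspose_mul]
  have htf : (flagIsometry m true)ᴴ * flagIsometry m false = 0 := by
    simp [flagIsometry_conjTranspose_mul]
  -- Rejected branches are invisible to the error projector because the flags are orthogonal, so the
  -- channels `RA`, `RB` play no role.
  have hrej : ∀ (M : Matrix (Qubits m × Qubits m) (Qubits n × Qubits n) ℂ) (σ),
      (flagIsometry m true)ᴴ * conjBy (flagIsometry m false * M) σ = 0 := fun M σ => by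
    rw [conjBy_apply, ← Matrix.mul_assoc, ← Matrix.mul_assoc, ← Matrix.mul_assoc, htf,
      Matrix.zero_mul, Matrix.zero_mul, Matrix.zero_mul]
  have hacc : ∀ y, (flagIsometry m true * eprCompl m * ((flagIsometry m true)ᴴ *
      conjBy (flagIsometry m true * (d.D y ⊗ₖ conjMatrix (d.D y))) ρ)).trace =
      ((C.syndromeProj y ⊗ₖ conjMatrix (C.syndromeProj y) -
        ((2 : ℂ) ^ m)⁻¹ • outer (rowVec (C.syndromeProj y))) * ρ).trace := by
    intro y
    set B := d.D y ⊗ₖ conjMatrix (d.D y) with hB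
    have hBB : Bᴴ * B = C.syndromeProj y ⊗ₖ conjMatrix (C.syndromeProj y) := by
      rw [hB, Matrix.conjTranspose_kronecker, kronecker_mul_kronecker, ← conjMatrix_conjTranspose,
        ← conjMatrix_mul, d.support]
    have hBr : Bᴴ *ᵥ rowVec 1 = rowVec (C.syndromeProj y) := by
      rw [hB, Matrix.conjTranspose_kronecker, ← conjMatrix_conjTranspose, kronecker_mulVec_rowVec,
        Matrix.mul_one, Matrix.conjTranspose_conjTranspose, d.support]
    have hBE : Bᴴ * eprCompl m * B = C.syndromeProj y ⊗ₖ conjMatrix (C.syndromeProj y) -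
        ((2 : ℂ) ^ m)⁻¹ • outer (rowVec (C.syndromeProj y)) := by
      have h := mul_outer_mul Bᴴ (rowVec 1)
      rw [Matrix.conjTranspose_conjTranspose, hBr] at h
      rw [eprCompl, Matrix.mul_sub, Matrix.sub_mul, Matrix.mul_one, hBB, Matrix.mul_smul,
        Matrix.smul_mul, h]
    have h1 : (flagIsometry m true)ᴴ * conjBy (flagIsometry m true * B) ρ =
        B * ρ * Bᴴ * (flagIsometry m true)ᴴ := by
      rw [conjBy_apply, Matrix.conjTranspose_mul, ← Matrix.mul_assoc, ← Matrix.mul_assoc,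
        ← Matrix.mul_assoc, ← Matrix.mul_assoc, htt, Matrix.one_mul]
    rw [h1, Matrix.mul_assoc, Matrix.trace_mul_comm, ← hBE, Matrix.mul_assoc, Matrix.mul_assoc _ _ᴴ,
      htt, Matrix.mul_one, Matrix.mul_assoc B, ← Matrix.mul_assoc (eprCompl m),
      Matrix.trace_mul_comm, Matrix.mul_assoc, Matrix.trace_mul_comm, Matrix.mul_assoc,
      ← Matrix.mul_assoc Bᴴ, ← Matrix.mul_assoc Bᴴ]
  have hy : ∀ y y' : C.Syndrome,
      (flagIsometry m true * eprCompl m * ((flagIsometry m true)ᴴ * if y = y' then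
        conjBy (flagIsometry m true * (d.D y ⊗ₖ conjMatrix (d.D y))) ρ
      else
        ∑ i, ∑ j, conjBy (flagIsometry m false * ((RA y y').kraus i ⊗ₖ (RB y y').kraus j))
          (conjBy (C.syndromeProj y ⊗ₖ conjMatrix (C.syndromeProj y')) ρ))).trace =
      if y = y' then ((C.syndromeProj y ⊗ₖ conjMatrix (C.syndromeProj y) -
        ((2 : ℂ) ^ m)⁻¹ • outer (rowVec (C.syndromeProj y))) * ρ).trace else 0 := by
    intro y y'
    split_ifs
    · exact hacc y
    · simp only [Matrix.mul_sum, hrej, Matrix.mul_zero, Finset.sum_const_zero, Matrix.trace_zero]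
  rw [codeProtocol_apply, Matrix.mul_assoc]
  simp only [Matrix.mul_sum (s := (Finset.univ : Finset C.Syndrome)), Matrix.trace_sum, hy,
    Finset.sum_ite_eq, Finset.mem_univ, if_true]
  rw [← Matrix.trace_sum, ← Finset.sum_mul, sum_syndrome_operator d, Matrix.smul_mul,
    Matrix.trace_smul, Finset.sum_mul, Matrix.trace_sum, smul_eq_mul]
  congr 1
  refine Finset.sum_congr rfl fun x _ => ?_
  split_ifs
  · rfl
  · rw [Matrix.zero_mul, Matrix.trace_zero]

end

theorem mainTheorem5 {n m : ℕ} {K : Type} [Fintype K] [Nonempty K]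
    (Q : K → StabilizerCode n) (ε : ℝ) (hε : 0 ≤ ε) (hQ : IsPurityTestingCode Q ε)
    (dec : ∀ k, (Q k).Decoder m)
    (RA RB : ∀ k, (Q k).Syndrome → (Q k).Syndrome → Channel n m) :
    IsPurityTestingProtocol (testProtocol Q dec RA RB) ε := by
  classical
  have hK : (0 : ℝ) < Fintype.card K := Nat.cast_pos.2 Fintype.card_pos
  have hlocc : IsLOCC (Qubits n) (Qubits n) (testProtocol Q dec RA RB) := by
    rw [testProtocol_eq]
    exact IsLOCC.average _ fun k => isLOCC_codeProtocol _ _ _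
  refine ⟨hlocc, ?_, fun ρ hρ htr => ?_⟩
  · rw [testProtocol_eq, LinearMap.smul_apply, LinearMap.sum_apply]
    simp only [codeProtocol_epr, Finset.sum_const, Finset.card_univ]
    rw [← Nat.cast_smul_eq_nsmul ℂ, smul_smul, inv_mul_cancel₀ (by exact_mod_cast hK.ne'),
      one_smul]
  -- Unnormalised Bell-basis distribution of ρ: since ⟨E_x|E_x⟩ = 2^n, the total is 2^n instead of
  -- 1.
  · set q : PauliVec n → ℝ := fun x => (outer (rowVec (pauli x)) * ρ).trace.re with hq
    have hq0 : ∀ x, 0 ≤ q x := fun x => by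
      rw [hq]
      simp only [trace_outer_mul]
      exact (Complex.nonneg_iff.1 (hρ.dotProduct_mulVec_nonneg _)).1
    have hq1 : ∑ x, q x = 2 ^ n := by
      simp only [hq]
      rw [← Complex.re_sum, ← Matrix.trace_sum, ← Finset.sum_mul, sum_outer_pauli, Matrix.smul_mul,
        Matrix.one_mul, Matrix.trace_smul, htr, smul_eq_mul, mul_one]
      norm_cast
    have hcard : ∀ x : PauliVec n,
        (∑ k, if x ∈ (Q k).perp \ (Q k).vectors then q x else 0) ≤ ε * Fintype.card K * q x := by
      intro x
      rw [← Finset.sum_filter, Finset.sum_const, nsmul_eq_mul]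
      refine mul_le_mul_of_nonneg_right ?_ (hq0 x)
      -- The purity testing hypothesis excludes x = 0, but 0 lies in every Q, so no code counts it
      -- and ε ≥ 0 suffices.
      by_cases hx : x = 0
      · subst hx
        rw [Finset.filter_false_of_mem fun k _ h => h.2 StabilizerCode.zero_mem_vectors]
        simpa using mul_nonneg hε hK.le
      · have h := hQ x hx
        rwa [Nat.card_eq_fintype_card, Fintype.card_subtype] at h
    have herr : (flagIsometry m true * eprCompl m * (flagIsometry m true)ᴴ *
        testProtocol Q dec RA RB ρ).trace.re ≤ ε := by
      rw [testProtocol_eq, LinearMap.smul_apply, LinearMap.sum_apply, Matrix.mul_smul,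
        Finset.mul_sum, Matrix.trace_smul, Matrix.trace_sum]
      simp only [trace_error_codeProtocol]
      rw [← Finset.mul_sum, smul_eq_mul, ← mul_assoc,
        show ((Fintype.card K : ℂ)⁻¹ * ((2 : ℂ) ^ n)⁻¹) =
          (((Fintype.card K : ℝ)⁻¹ * ((2 : ℝ) ^ n)⁻¹ : ℝ) : ℂ) by push_cast; rfl,
        Complex.re_ofReal_mul, Complex.re_sum]
      simp only [Complex.re_sum, apply_ite Complex.re, Complex.zero_re]
      -- With x outermost, the codes failing on a fixed error can be counted by `hcard`.
      rw [Finset.sum_comm, ← mul_inv, inv_mul_le_iff₀ (by positivity)]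
      refine (Finset.sum_le_sum fun x _ => hcard x).trans ?_
      rw [← Finset.mul_sum, hq1]
      exact le_of_eq (by ring)
    rw [projMatrix_goodSpace, Matrix.sub_mul, Matrix.one_mul, Matrix.trace_sub, hlocc.trace_eq, htr,
      Complex.sub_re, Complex.one_re]
    linarith
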